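/- Fix $a>0$, $\gamma>1$ and $1\le p<2$. For $f\in L^p(\mathbb R)$ (complex-valued) let $\hat f$ denote its Fourier transform, with the convention $\hat f(\xi)=\int_{\mathbb R} f(x)e^{-ix\xi}\,dx$ for integrable $f$ and understood in the sense of distributions in general (for $1\le p<2$ it is a locally integrable function), and for $t>0$ put $$P_{a,\gamma}^t f(x)=\frac1{2\pi}\int_{\mathbb R}\hat f(\xi)\,e^{ix\xi}e^{it|\xi|^a}e^{-t^\gamma|\xi|^a}\,d\xi,\qquad P_{a,\gamma}^*f(x)=\sup_{0<t<1}\bigl|P_{a,\gamma}^tf(x)\bigr|\in[0,\infty].$$ Suppose that for every $f\in L^p(\mathbb R)$ one has $\lim_{t\to0^+}P_{a,\gamma}^tf(x)=f(x)$ for almost every $x\in\mathbb R$. Then for every $\varepsilon>0$ there exist a measurable set $E_\varepsilon\subset[0,1]$ with $|E_\varepsilon|>1-\varepsilon$ and a constant $C_\varepsilon>0$ such that $$\bigl|\{x\in E_\varepsilon : P_{a,\gamma}^*f(x)>\lambda\}\bigr|\le C_\varepsilon\,\lambda^{-p}\,\|f\|_{L^p(\mathbb R)}^p$$ for all $\lambda>0$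 and all $f\in L^p(\mathbb R)$. -/

import Mathlib

open MeasureTheory Filter Topology
open scoped ENNReal NNReal ContDiff

noncomputable section

namespace LandauSchrodinger

/-- The locally integrable function `g` is the Fourier transform of `f`, in the sense of
distributions and with the convention `f̂(ξ) = ∫ f(x) e^{-ixξ} dx`, that is,
`∫ g φ = ∫ f φ̂` for every `φ ∈ C_c^∞(ℝ)`.
For `f ∈ L^p(ℝ)` with `1 ≤ p ≤ 2` such a `g` exists and is unique almost everywhere. -/
def IsFourierTransform (f g : ℝ → ℂ) : Prop :=
  LocallyIntegrable g volume ∧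
    ∀ φ : ℝ → ℂ, ContDiff ℝ ∞ φ → HasCompactSupport φ →
      ∫ ξ : ℝ, g ξ * φ ξ =
        ∫ x : ℝ, f x * ∫ ξ : ℝ, Complex.exp (-(Complex.I * x * ξ)) * φ ξ

open Classical in
/-- A representative of the Fourier transform `f̂` of `f` (and `0` if `f̂` is not a locally
integrable function, which does not happen for `f ∈ L^p(ℝ)`, `1 ≤ p ≤ 2`). -/
def fourierHat (f : ℝ → ℂ) : ℝ → ℂ :=
  if h : ∃ g : ℝ → ℂ, IsFourierTransform f g then h.choose else 0

/-- The Landau type Schrödinger operator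
`P_{a,γ}^t f(x) = (1/2π) ∫ f̂(ξ) e^{ixξ} e^{it|ξ|^a} e^{-t^γ |ξ|^a} dξ`. -/
def landauOp (a γ t : ℝ) (f : ℝ → ℂ) (x : ℝ) : ℂ :=
  (1 / (2 * (Real.pi : ℂ))) *
    ∫ ξ : ℝ, fourierHat f ξ * Complex.exp (Complex.I * x * ξ) *
      Complex.exp (Complex.I * t * ((|ξ| ^ a : ℝ) : ℂ)) *
      ((Real.exp (-(t ^ γ * |ξ| ^ a)) : ℝ) : ℂ)

/-- The maximal operator `P_{a,γ}^* f(x) = sup_{0<t<1} |P_{a,γ}^t f(x)|`, valued in `[0,∞]`. -/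
def landauMaximal (a γ : ℝ) (f : ℝ → ℂ) (x : ℝ) : ℝ≥0∞ :=
  ⨆ t ∈ Set.Ioo (0 : ℝ) 1, ‖landauOp a γ t f x‖ₑ

end LandauSchrodinger

end

/-! This is Nikishin's theorem in the form valid for spaces of type `p`; the dispersive structure of
the operator plays almost no role. For fixed `t` and `x`, `f ↦ P^t f(x)` is a continuous functional
on `L^p`, because `f̂` is a bounded function plus an `L²` function and the damping factor lies in
`L^1 ∩ L^2`. Convergence as `t → 0⁺` controls small `t` and damping controls the rest, so the
maximal function is finite almost everywhere (`landauMaximal_lt_top`). Baire's theorem then makes it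
bounded in measure on the unit ball, uniformly in `f` (`exists_measure_lt_maximalFn_le`). Averaging
over random signs, with the type `p` inequality for `L^p`, extends this to the supremum over finite
families with `∑ ‖g i‖ ^ p ≤ 1` (`exists_measure_exists_lt_maximalFn_le`). Finally, a maximal
disjoint family of sets violating the weak-type bound has small union, and off this union the bound
holds (`exists_weakType_maximalFn`). -/

namespace LandauSchrodinger

/-! ### Maximal functions and the Banach principle -/

section WeakType

variable {α E ι : Type*} [NormedAddCommGroup E] [NormedSpace ℂ E]

/-- The maximal function `x ↦ sup_i |T_i f(x)|` of a family of linear operators. -/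
noncomputable def maximalFn (T : ι → α → E →L[ℂ] ℂ) (f : E) (x : α) : ℝ≥0∞ :=
  ⨆ i, ‖T i x f‖ₑ

variable (T : ι → α → E →L[ℂ] ℂ)

lemma maximalFn_add_le (f g : E) (x : α) :
    maximalFn T (f + g) x ≤ maximalFn T f x + maximalFn T g x := by
  refine iSup_le fun i => ?_
  rw [map_add]
  exact (enorm_add_le _ _).trans
    (add_le_add (le_iSup (fun i => ‖T i x f‖ₑ) i) (le_iSup (fun i => ‖T i x g‖ₑ) i))

lemma maximalFn_smul (c : ℂ) (f : E) (x : α) :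
    maximalFn T (c • f) x = ‖c‖ₑ * maximalFn T f x := by
  simp [maximalFn, ENNReal.mul_iSup]

lemma maximalFn_neg (f : E) (x : α) : maximalFn T (-f) x = maximalFn T f x := by
  simp [maximalFn]

lemma maximalFn_sub_le (f g : E) (x : α) :
    maximalFn T (f - g) x ≤ maximalFn T f x + maximalFn T g x := by
  simpa [sub_eq_add_neg, maximalFn_neg] using maximalFn_add_le T f (-g) x

/-- Since `2g = (f + g) - (f - g)`, bounds by `C` on both sides would pass to `g`. Hence a large `g`
cannot be cancelled for both choices of sign. -/
lemma lt_maximalFn_add_or_sub {C : ℝ≥0∞} {f g : E} {x : α} (h : C < maximalFn T g x) :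
    C < maximalFn T (f + g) x ∨ C < maximalFn T (f - g) x := by
  by_contra! hc
  have h2 := maximalFn_sub_le T (f + g) (f - g) x
  have h3 : f + g - (f - g) = (2 : ℂ) • g := by rw [two_smul]; abel
  rw [h3, maximalFn_smul] at h2
  have h4 : ‖(2 : ℂ)‖ₑ = 2 := by
    rw [← ofReal_norm]; simp
  rw [h4] at h2
  have h5 : 2 * maximalFn T g x ≤ 2 * C := by
    rw [two_mul C]; exact h2.trans (add_le_add hc.1 hc.2)
  have h6 := (ENNReal.mul_le_mul_iff_right (by norm_num) (by norm_num)).1 h5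
  exact absurd h (not_lt.2 h6)

variable [MeasurableSpace α] {μ : Measure α}

/-- A strict inequality `C < ‖T i x f‖ₑ` persists along `u k → f`, so the superlevel set of `f` lies
in the lower limit of those of `u k`, an increasing union of sets of measure at most `η`. The index
set may be uncountable. -/
lemma isClosed_setOf_measure_lt_maximalFn_le (C η : ℝ≥0∞) :
    IsClosed {f : E | μ {x | C < maximalFn T f x} ≤ η} := by
  refine IsSeqClosed.isClosed fun u f hu huf => ?_
  have hsub : {x | C < maximalFn T f x} ⊆ ⋃ N : ℕ, ⋂ k ≥ N, {x | C < maximalFn T (u k) x} := by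
    intro x hx
    obtain ⟨i, hi⟩ := lt_iSup_iff.1 (show C < ⨆ i, ‖T i x f‖ₑ from hx)
    have hlim : Tendsto (fun k => ‖T i x (u k)‖ₑ) atTop (𝓝 ‖T i x f‖ₑ) :=
      (((T i x).continuous.enorm).tendsto f).comp huf
    obtain ⟨N, hN⟩ := eventually_atTop.1 (hlim.eventually_const_lt hi)
    simp only [Set.mem_iUnion, Set.mem_iInter, Set.mem_ofPred_eq]
    exact ⟨N, fun k hk => (hN k hk).trans_le (le_iSup (fun i => ‖T i x (u k)‖ₑ) i)⟩
  have hmono : Monotone fun N : ℕ => ⋂ k ≥ N, {x | C < maximalFn T (u k) x} := by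
    intro M N hMN x hx
    simp only [Set.mem_iInter] at hx ⊢
    exact fun k hk => hx k (hMN.trans hk)
  refine (measure_mono hsub).trans ?_
  rw [hmono.measure_iUnion]
  exact iSup_le fun N => (measure_mono (Set.biInter_subset_of_mem (le_refl N))).trans (hu N)

/-- The Banach principle: a maximal operator that is finite almost everywhere is bounded
in measure on the unit ball. -/
lemma exists_measure_lt_maximalFn_le [CompleteSpace E] [IsFiniteMeasure μ]
    (hmeas : ∀ f, Measurable (maximalFn T f))
    (hfin : ∀ f, ∀ᵐ x ∂μ, maximalFn T f x < ⊤) {η : ℝ≥0∞} (hη : η ≠ 0) :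
    ∃ C : ℝ, 0 < C ∧ ∀ f : E, ‖f‖ ≤ 1 → μ {x | ENNReal.ofReal C < maximalFn T f x} ≤ η := by
  have hη2 : 0 < η / 2 := ENNReal.half_pos hη
  have hcover : ⋃ n : ℕ, {f : E | μ {x | (n : ℝ≥0∞) < maximalFn T f x} ≤ η / 2} = Set.univ := by
    refine Set.eq_univ_of_forall fun f => Set.mem_iUnion.2 ?_
    have hanti : Antitone fun n : ℕ => {x | (n : ℝ≥0∞) < maximalFn T f x} := by
      intro m n hmn x hx
      have hmn' : (m : ℝ≥0∞) ≤ n := by exact_mod_cast hmn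
      exact hmn'.trans_lt hx
    have hlim := tendsto_measure_iInter_atTop (μ := μ)
      (fun n : ℕ => (measurableSet_lt measurable_const (hmeas f)).nullMeasurableSet) hanti
      ⟨0, measure_ne_top _ _⟩
    have h0 : μ (⋂ n : ℕ, {x | (n : ℝ≥0∞) < maximalFn T f x}) = 0 := by
      refine measure_mono_null ?_ (ae_iff.1 (hfin f))
      intro x hx hlt
      obtain ⟨n, hn⟩ := ENNReal.exists_nat_gt hlt.ne
      exact lt_asymm hn (Set.mem_iInter.1 hx n)
    rw [h0] at hlim
    obtain ⟨n, hn⟩ := (hlim.eventually_lt_const hη2).exists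
    exact ⟨n, hn.le⟩
  -- Baire: one of the closed sets covering `E` contains a ball.
  obtain ⟨n, f₀, hf₀⟩ := nonempty_interior_of_iUnion_of_closed
    (fun n : ℕ => isClosed_setOf_measure_lt_maximalFn_le T (μ := μ) (n : ℝ≥0∞) (η / 2)) hcover
  obtain ⟨r, hr, hball⟩ := Metric.isOpen_iff.1 isOpen_interior f₀ hf₀
  have hball' : ∀ g ∈ Metric.ball f₀ r, μ {x | (n : ℝ≥0∞) < maximalFn T g x} ≤ η / 2 :=
    fun g hg => (interior_subset (hball hg) :
      g ∈ {f : E | μ {x | (n : ℝ≥0∞) < maximalFn T f x} ≤ η / 2})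
  -- Write `(r/2) h` as a difference of two points of the ball: its maximal function is at most `2n`
  -- off two sets of measure `η / 2`. Using `n + 1` makes the constant positive and the
  -- contradiction strict.
  refine ⟨2 * (n + 1) / (r / 2), by positivity, fun h hh => ?_⟩
  have hmem : f₀ + ((r / 2 : ℝ) : ℂ) • h ∈ Metric.ball f₀ r := by
    rw [mem_ball_iff_norm, add_sub_cancel_left, norm_smul, Complex.norm_real, Real.norm_eq_abs,
      abs_of_pos (by positivity)]
    nlinarith
  have hsub : {x | ENNReal.ofReal (2 * (n + 1) / (r / 2)) < maximalFn T h x} ⊆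
      {x | (n : ℝ≥0∞) < maximalFn T (f₀ + ((r / 2 : ℝ) : ℂ) • h) x} ∪
        {x | (n : ℝ≥0∞) < maximalFn T f₀ x} := by
    intro x hx
    by_contra hc
    simp only [Set.mem_union, Set.mem_ofPred_eq, not_or, not_lt] at hc hx
    have h1 := maximalFn_sub_le T (f₀ + ((r / 2 : ℝ) : ℂ) • h) f₀ x
    rw [add_sub_cancel_left, maximalFn_smul] at h1
    have h2 : ‖((r / 2 : ℝ) : ℂ)‖ₑ = ENNReal.ofReal (r / 2) := by
      rw [← ofReal_norm, Complex.norm_real, Real.norm_eq_abs, abs_of_pos (by positivity)]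
    rw [h2] at h1
    have h3 := h1.trans (add_le_add hc.1 hc.2)
    have h4 : ENNReal.ofReal (r / 2) * ENNReal.ofReal (2 * (n + 1) / (r / 2)) ≤ n + n :=
      (mul_le_mul_right hx.le _).trans h3
    rw [← ENNReal.ofReal_mul (by positivity), mul_div_cancel₀ _ (by positivity)] at h4
    have h5 : (n : ℝ≥0∞) + n = ENNReal.ofReal (n + n) := by
      rw [ENNReal.ofReal_add (by positivity) (by positivity), ENNReal.ofReal_natCast]
    rw [h5, ENNReal.ofReal_le_ofReal_iff (by positivity)] at h4
    linarith
  calc _ ≤ _ := measure_mono hsub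
    _ ≤ _ := measure_union_le _ _
    _ ≤ η / 2 + η / 2 := add_le_add (hball' _ hmem) (hball' _ (Metric.mem_ball_self hr))
    _ = η := ENNReal.add_halves η

/-! ### Random signs and type `p` -/

section Signs

variable {κ : Type*} [DecidableEq κ]

/-- The sum `∑ i ∈ t, ± g i`, with sign `+` exactly for `i ∈ s`. -/
def signedSum {E : Type*} [AddCommGroup E] (g : κ → E) (t s : Finset κ) : E :=
  ∑ i ∈ t, if i ∈ s then g i else -g i

lemma signedSum_insert_left {E : Type*} [AddCommGroup E] (g : κ → E) {t s : Finset κ} {i : κ} (hi : i ∉ t) (hs : s ⊆ t) :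
    signedSum g (insert i t) s = signedSum g t s - g i := by
  rw [signedSum, Finset.sum_insert hi, if_neg fun h => hi (hs h), signedSum]
  abel

lemma signedSum_insert_insert {E : Type*} [AddCommGroup E] (g : κ → E) {t s : Finset κ} {i : κ} (hi : i ∉ t) :
    signedSum g (insert i t) (insert i s) = signedSum g t s + g i := by
  rw [signedSum, Finset.sum_insert hi, if_pos (Finset.mem_insert_self i s), signedSum, add_comm]
  congr 1
  refine Finset.sum_congr rfl fun j hj => ?_
  have : j ≠ i := fun h => hi (h ▸ hj)
  simp [Finset.mem_insert, this]

/-- Type `p` with constant one. -/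
lemma sum_norm_signedSum_rpow_le {E : Type*} [NormedAddCommGroup E] {p : ℝ} (hp : 0 < p)
    (hpar : ∀ f g : E, ‖f + g‖ ^ p + ‖f - g‖ ^ p ≤ 2 * (‖f‖ ^ p + ‖g‖ ^ p))
    (g : κ → E) (t : Finset κ) :
    ∑ s ∈ t.powerset, ‖signedSum g t s‖ ^ p ≤ 2 ^ t.card * ∑ i ∈ t, ‖g i‖ ^ p := by
  induction t using Finset.induction_on with
  | empty => simp [signedSum, Real.zero_rpow hp.ne']
  | insert i t hi ih =>
    rw [Finset.sum_powerset_insert hi, ← Finset.sum_add_distrib, Finset.card_insert_of_notMem hi,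
      Finset.sum_insert hi]
    calc ∑ s ∈ t.powerset, (‖signedSum g (insert i t) s‖ ^ p +
          ‖signedSum g (insert i t) (insert i s)‖ ^ p)
        ≤ ∑ s ∈ t.powerset, 2 * (‖signedSum g t s‖ ^ p + ‖g i‖ ^ p) := by
          refine Finset.sum_le_sum fun s hs => ?_
          rw [signedSum_insert_left g hi (Finset.mem_powerset.1 hs), signedSum_insert_insert g hi,
            add_comm]
          exact hpar _ _
      _ = 2 * (∑ s ∈ t.powerset, ‖signedSum g t s‖ ^ p + 2 ^ t.card * ‖g i‖ ^ p) := by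
          rw [← Finset.mul_sum, Finset.sum_add_distrib]
          simp [Finset.card_powerset]
      _ ≤ 2 * (2 ^ t.card * ∑ i ∈ t, ‖g i‖ ^ p + 2 ^ t.card * ‖g i‖ ^ p) := by gcongr
      _ = _ := by ring

/-- If one of the maximal functions exceeds `C`, then so does that of at least half of the signed
sums. -/
lemma two_pow_le_sum_indicator_lt_maximalFn {α : Type*} (T : ι → α → E →L[ℂ] ℂ) {C : ℝ≥0∞} {g : κ → E} {t : Finset κ} {x : α}
    (h : ∃ i ∈ t, C < maximalFn T (g i) x) :
    (2 : ℝ≥0∞) ^ t.card ≤ 2 * ∑ s ∈ t.powerset,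
      Set.indicator {x | C < maximalFn T (signedSum g t s) x} (fun _ => (1 : ℝ≥0∞)) x := by
  obtain ⟨i, hmem, hi⟩ := h
  -- Pair the sign choices differing only at `i`; at least one of each pair exceeds `C`.
  obtain ⟨t, hit, rfl⟩ : ∃ t' : Finset κ, i ∉ t' ∧ insert i t' = t :=
    ⟨t.erase i, Finset.notMem_erase i t, Finset.insert_erase hmem⟩
  rw [Finset.sum_powerset_insert hit, ← Finset.sum_add_distrib, Finset.card_insert_of_notMem hit,
    pow_succ, mul_comm]
  gcongr
  calc (2 : ℝ≥0∞) ^ t.card = ∑ s ∈ t.powerset, 1 := by simp [Finset.card_powerset]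
    _ ≤ _ := by
      refine Finset.sum_le_sum fun s hs => ?_
      rw [signedSum_insert_left g hit (Finset.mem_powerset.1 hs), signedSum_insert_insert g hit]
      rcases lt_maximalFn_add_or_sub T (f := signedSum g t s) hi with h | h
      · refine le_trans ?_ le_add_self
        rw [Set.indicator_of_mem (by exact h)]
      · refine le_trans ?_ le_self_add
        rw [Set.indicator_of_mem (by exact h)]

end Signs

/-! ### Nikishin's theorem -/

/-- Boundedness in measure self-improves to finite families in a space of type `p`. -/
lemma exists_measure_exists_lt_maximalFn_le [CompleteSpace E] [IsProbabilityMeasure μ]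
    {κ : Type*} {p : ℝ} (hp : 0 < p)
    (hpar : ∀ f g : E, ‖f + g‖ ^ p + ‖f - g‖ ^ p ≤ 2 * (‖f‖ ^ p + ‖g‖ ^ p))
    (hmeas : ∀ f, Measurable (maximalFn T f))
    (hfin : ∀ f, ∀ᵐ x ∂μ, maximalFn T f x < ⊤) {η : ℝ} (hη : 0 < η) :
    ∃ C : ℝ, 0 < C ∧ ∀ (g : κ → E) (t : Finset κ), ∑ i ∈ t, ‖g i‖ ^ p ≤ 1 →
      μ {x | ∃ i ∈ t, ENNReal.ofReal C < maximalFn T (g i) x} ≤ ENNReal.ofReal η := by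
  classical
  obtain ⟨C, hC, hball⟩ := exists_measure_lt_maximalFn_le T hmeas hfin (μ := μ)
    (η := ENNReal.ofReal (η / 4)) (by simpa using hη)
  -- With `R ^ p = 4 / η`, the bound `key` follows by scaling when `‖h‖ ≤ R`, and is at least `1`,
  -- hence trivial, when `‖h‖ > R`.
  set R : ℝ := (4 / η) ^ (1 / p) with hR
  have hRpos : 0 < R := by positivity
  have hRp : R ^ p = 4 / η := by
    rw [hR, ← Real.rpow_mul (by positivity), one_div_mul_cancel hp.ne', Real.rpow_one]
  have key : ∀ h : E, μ {x | ENNReal.ofReal (R * C) < maximalFn T h x} ≤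
      ENNReal.ofReal (η / 4 + η / 4 * ‖h‖ ^ p) := by
    intro h
    by_cases hh : ‖h‖ ≤ R
    · have hc : ‖((R⁻¹ : ℝ) : ℂ)‖ = R⁻¹ := by
        rw [Complex.norm_real, Real.norm_eq_abs, abs_of_pos (by positivity)]
      have h1 : ‖((R⁻¹ : ℝ) : ℂ) • h‖ ≤ 1 := by
        rw [norm_smul, hc, inv_mul_le_iff₀ hRpos]; simpa using hh
      refine (measure_mono ?_).trans ((hball _ h1).trans
        (ENNReal.ofReal_le_ofReal (le_add_of_nonneg_right (by positivity))))
      intro x hx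
      simp only [Set.mem_ofPred_eq] at hx ⊢
      rw [maximalFn_smul, ← ofReal_norm, hc]
      have h2 : C = R⁻¹ * (R * C) := by field_simp
      rw [h2, ENNReal.ofReal_mul (by positivity)]
      exact (ENNReal.mul_lt_mul_iff_right (by simpa using hRpos) ENNReal.ofReal_ne_top).2 hx
    · push Not at hh
      refine prob_le_one.trans ?_
      rw [← ENNReal.ofReal_one]
      refine ENNReal.ofReal_le_ofReal ?_
      have h1 : 4 / η ≤ ‖h‖ ^ p := hRp ▸ Real.rpow_le_rpow hRpos.le hh.le hp.le
      have h2 : η / 4 * (4 / η) = 1 := by field_simp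
      have h3 : η / 4 * (4 / η) ≤ η / 4 * ‖h‖ ^ p := by gcongr
      linarith
  refine ⟨R * C, by positivity, fun g t hg => ?_⟩
  set A := {x | ∃ i ∈ t, ENNReal.ofReal (R * C) < maximalFn T (g i) x} with hA
  have hms : ∀ h : E, MeasurableSet {x | ENNReal.ofReal (R * C) < maximalFn T h x} :=
    fun h => measurableSet_lt measurable_const (hmeas h)
  have hAm : MeasurableSet A := by
    have : A = ⋃ i ∈ t, {x | ENNReal.ofReal (R * C) < maximalFn T (g i) x} := by
      ext x; simp [hA]
    rw [this]
    exact Finset.measurableSet_biUnion t fun i _ => hms (g i)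
  -- Sum over signs: at least half of them are large on `A`, and type `p` bounds the sum of `η/4 +
  -- η/4 * ‖·‖ ^ p` by `2 ^ t.card * (η/2)`.
  have h1 : (2 : ℝ≥0∞) ^ t.card * μ A ≤ 2 ^ t.card * ENNReal.ofReal η := by
    calc (2 : ℝ≥0∞) ^ t.card * μ A = ∫⁻ x in A, 2 ^ t.card ∂μ := by simp
      _ ≤ ∫⁻ x in A, 2 * ∑ s ∈ t.powerset, Set.indicator
          {x | ENNReal.ofReal (R * C) < maximalFn T (signedSum g t s) x}
          (fun _ => (1 : ℝ≥0∞)) x ∂μ :=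
          setLIntegral_mono' hAm fun x hx => two_pow_le_sum_indicator_lt_maximalFn T hx
      _ ≤ ∫⁻ x, 2 * ∑ s ∈ t.powerset, Set.indicator
          {x | ENNReal.ofReal (R * C) < maximalFn T (signedSum g t s) x}
          (fun _ => (1 : ℝ≥0∞)) x ∂μ := setLIntegral_le_lintegral _ _
      _ = 2 * ∑ s ∈ t.powerset,
          μ {x | ENNReal.ofReal (R * C) < maximalFn T (signedSum g t s) x} := by
          rw [lintegral_const_mul' _ _ (by norm_num), lintegral_finsetSum _
            fun s _ => measurable_const.indicator (hms _)]
          simp [lintegral_indicator (hms _)]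
      _ ≤ 2 * ∑ s ∈ t.powerset, ENNReal.ofReal (η / 4 + η / 4 * ‖signedSum g t s‖ ^ p) := by
          gcongr with s
          exact key _
      _ = ENNReal.ofReal (2 * ∑ s ∈ t.powerset, (η / 4 + η / 4 * ‖signedSum g t s‖ ^ p)) := by
          rw [ENNReal.ofReal_mul (by norm_num), ENNReal.ofReal_sum_of_nonneg
            fun s _ => by positivity]
          simp
      _ ≤ ENNReal.ofReal (2 ^ t.card * η) := by
          refine ENNReal.ofReal_le_ofReal ?_
          rw [Finset.sum_add_distrib, ← Finset.mul_sum]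
          have h2 := sum_norm_signedSum_rpow_le hp hpar g t
          have h3 : (2 : ℝ) ^ t.card * ∑ i ∈ t, ‖g i‖ ^ p ≤ 2 ^ t.card * 1 := by gcongr
          simp only [Finset.sum_const, Finset.card_powerset, nsmul_eq_mul]
          push_cast
          nlinarith [h2.trans h3]
      _ = 2 ^ t.card * ENNReal.ofReal η := by
          rw [ENNReal.ofReal_mul (by positivity), ENNReal.ofReal_pow (by norm_num)]
          simp
  exact (ENNReal.mul_le_mul_iff_right (by simp) (by simp)).1 h1

/-- Nikishin's theorem for maximal operators on a space of type `p` with constant one. -/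
theorem exists_weakType_maximalFn [CompleteSpace E] [IsProbabilityMeasure μ]
    {p : ℝ} (hp : 0 < p)
    (hpar : ∀ f g : E, ‖f + g‖ ^ p + ‖f - g‖ ^ p ≤ 2 * (‖f‖ ^ p + ‖g‖ ^ p))
    (hmeas : ∀ f, Measurable (maximalFn T f))
    (hfin : ∀ f, ∀ᵐ x ∂μ, maximalFn T f x < ⊤) {η : ℝ} (hη : 0 < η) :
    ∃ G : Set α, MeasurableSet G ∧ μ Gᶜ ≤ ENNReal.ofReal η ∧ ∃ C : ℝ, 0 < C ∧
      ∀ lam : ℝ, 0 < lam → ∀ f : E,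
        μ (G ∩ {x | ENNReal.ofReal lam < maximalFn T f x}) ≤
          ENNReal.ofReal ((C / lam * ‖f‖) ^ p) := by
  classical
  obtain ⟨C, hC, hfam⟩ := exists_measure_exists_lt_maximalFn_le T hp hpar hmeas hfin (μ := μ)
    (κ := Set α) hη
  -- `F` witnesses a failure of the weak-type bound, with `g` rescaled so that the level is always
  -- `C`.
  let Bad : Set α → E → Prop := fun F g => MeasurableSet F ∧
    (∀ x ∈ F, ENNReal.ofReal C < maximalFn T g x) ∧ ENNReal.ofReal (‖g‖ ^ p) < μ F
  let 𝓢 : Set (Set (Set α)) := {S | S.PairwiseDisjoint id ∧ ∀ F ∈ S, ∃ g, Bad F g}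
  obtain ⟨S, hS⟩ : ∃ S, Maximal (· ∈ 𝓢) S := by
    refine zorn_subset 𝓢 fun c hc hchain => ⟨⋃₀ c, ⟨?_, ?_⟩, fun s hs => Set.subset_sUnion_of_mem hs⟩
    · exact (Set.pairwiseDisjoint_sUnion hchain.directedOn).2 fun s hs => (hc hs).1
    · rintro F ⟨s, hs, hF⟩
      exact (hc hs).2 F hF
  obtain ⟨hdisj, hbad⟩ := hS.prop
  choose! g hg using hbad
  have hcount : S.Countable := by
    have h1 := Measure.countable_meas_pos_of_disjoint_iUnion (μ := μ) (As := fun F : S => (F : Set α))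
      (fun F => (hg F F.2).1) (fun F F' h => hdisj F.2 F'.2 (fun h' => h (Subtype.ext h')))
    have h2 : {F : S | 0 < μ (F : Set α)} = Set.univ :=
      Set.eq_univ_of_forall fun F => (zero_le).trans_lt (hg F F.2).2.2
    rw [h2] at h1
    exact Set.countable_coe_iff.1 (Set.countable_univ_iff.1 h1)
  have hUm : MeasurableSet (⋃₀ S) := MeasurableSet.sUnion hcount fun F hF => (hg F hF).1
  -- On a finite subfamily, `∑ ‖g F‖ ^ p ≤ ∑ μ F ≤ 1` by disjointness, so the estimate for finite
  -- families applies.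
  have hU : μ (⋃₀ S) ≤ ENNReal.ofReal η := by
    rw [measure_sUnion hcount hdisj fun F hF => (hg F hF).1, ENNReal.tsum_eq_iSup_sum]
    refine iSup_le fun t => ?_
    set t' : Finset (Set α) := t.map (Function.Embedding.subtype _) with ht'
    have ht'S : ∀ F ∈ t', F ∈ S := by
      intro F hF
      simp only [ht', Finset.mem_map, Function.Embedding.subtype_apply] at hF
      obtain ⟨F', -, rfl⟩ := hF
      exact F'.2
    have hsum : ∑ F ∈ t, μ (F : Set α) = μ (⋃ F ∈ t', F) := by
      rw [measure_biUnion_finset (f := fun F => F)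
        (fun F hF F' hF' h => hdisj (ht'S F hF) (ht'S F' hF') h)
        fun F hF => (hg F (ht'S F hF)).1]
      simp [ht']
    rw [hsum]
    refine (measure_mono ?_).trans (hfam g t' ?_)
    · intro x hx
      simp only [Set.mem_iUnion] at hx
      obtain ⟨F, hF, hxF⟩ := hx
      exact ⟨F, hF, (hg F (ht'S F hF)).2.1 x hxF⟩
    · rw [← ENNReal.ofReal_le_ofReal_iff zero_le_one, ENNReal.ofReal_one,
        ENNReal.ofReal_sum_of_nonneg fun F _ => by positivity]
      calc ∑ F ∈ t', ENNReal.ofReal (‖g F‖ ^ p) ≤ ∑ F ∈ t', μ F :=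
            Finset.sum_le_sum fun F hF => (hg F (ht'S F hF)).2.2.le
        _ = μ (⋃ F ∈ t', F) := by rw [← hsum]; simp [ht']
        _ ≤ 1 := prob_le_one
  refine ⟨(⋃₀ S)ᶜ, hUm.compl, by rwa [compl_compl], C, hC, fun lam hlam f => ?_⟩
  by_contra! hlt
  set F := (⋃₀ S)ᶜ ∩ {x | ENNReal.ofReal lam < maximalFn T f x} with hF
  have hc : ‖((C / lam : ℝ) : ℂ)‖ = C / lam := by
    rw [Complex.norm_real, Real.norm_eq_abs, abs_of_pos (by positivity)]
  have hFbad : Bad F (((C / lam : ℝ) : ℂ) • f) := by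
    refine ⟨hUm.compl.inter (measurableSet_lt measurable_const (hmeas f)), fun x hx => ?_, ?_⟩
    · rw [maximalFn_smul, ← ofReal_norm, hc]
      have h2 : C = C / lam * lam := by field_simp
      conv_lhs => rw [h2]
      rw [ENNReal.ofReal_mul (by positivity)]
      exact (ENNReal.mul_lt_mul_iff_right (by simpa using by positivity)
        ENNReal.ofReal_ne_top).2 hx.2
    · rwa [norm_smul, hc]
  have hdF : ∀ F' ∈ S, Disjoint F F' := fun F' hF' =>
    Set.disjoint_left.2 fun x hx hx' => hx.1 ⟨F', hF', hx'⟩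
  have hins : insert F S ∈ 𝓢 := by
    refine ⟨hdisj.insert fun F' hF' _ => hdF F' hF', ?_⟩
    rintro F' (rfl | hF')
    · exact ⟨_, hFbad⟩
    · exact ⟨_, hg F' hF'⟩
  -- Maximality puts `F` in `S`, yet `F` avoids the union of `S`; so `F` is empty, against its
  -- positive measure.
  have hFS : F ∈ S := hS.le_of_ge hins (Set.subset_insert F S) (Set.mem_insert F S)
  have hempty : F = ∅ := disjoint_self.1 (hdF F hFS)
  rw [hempty, measure_empty] at hlt
  exact not_lt_bot hlt

end WeakType

/-! ### Type `p` and the splitting of `L^p` -/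

section Lp

/-- The parallelogram law gives the case `p = 2`; concavity and subadditivity of `x ↦ x ^ (p / 2)`
give the others. -/
lemma norm_add_rpow_add_norm_sub_rpow_le {p : ℝ} (hp1 : 1 ≤ p) (hp2 : p ≤ 2) (z w : ℂ) :
    ‖z + w‖ ^ p + ‖z - w‖ ^ p ≤ 2 * (‖z‖ ^ p + ‖w‖ ^ p) := by
  have hsq : ∀ r : ℝ, 0 ≤ r → (r ^ 2) ^ (p / 2) = r ^ p := by
    intro r hr
    rw [← Real.rpow_natCast, ← Real.rpow_mul hr]
    congr 1
    push_cast
    ring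
  have hpar := parallelogram_law_with_norm ℝ z w
  have hconc' : ConcaveOn ℝ (Set.Ici 0) fun x : ℝ => x ^ (p / 2) :=
    Real.concaveOn_rpow (by linarith) (by linarith)
  have hhalf : (0 : ℝ) ≤ 1 / 2 := by norm_num
  have hconc := hconc'.2 (Set.mem_Ici.2 (sq_nonneg ‖z + w‖)) (Set.mem_Ici.2 (sq_nonneg ‖z - w‖))
    hhalf hhalf (by norm_num)
  simp only [smul_eq_mul, hsq _ (norm_nonneg _)] at hconc
  have hmid : 1 / 2 * ‖z + w‖ ^ 2 + 1 / 2 * ‖z - w‖ ^ 2 = ‖z‖ ^ 2 + ‖w‖ ^ 2 := by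
    nlinarith [hpar]
  rw [hmid] at hconc
  have hsub := Real.rpow_add_le_add_rpow (p := p / 2) (sq_nonneg ‖z‖) (sq_nonneg ‖w‖) (by linarith)
    (by linarith)
  rw [hsq _ (norm_nonneg _), hsq _ (norm_nonneg _)] at hsub
  linarith

variable {p : ℝ}

lemma integrable_norm_rpow_of_memLp (hp1 : 1 ≤ p) {f : ℝ → ℂ}
    (hf : MemLp f (ENNReal.ofReal p) volume) : Integrable (fun x => ‖f x‖ ^ p) := by
  have := hf.integrable_norm_rpow (by simp; linarith) ENNReal.ofReal_ne_top
  rwa [ENNReal.toReal_ofReal (by linarith)] at this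

lemma norm_Lp_rpow_eq_integral {q : ℝ≥0∞} (hq : q = ENNReal.ofReal p) (hp1 : 1 ≤ p)
    (f : Lp ℂ q (volume : Measure ℝ)) : ‖f‖ ^ p = ∫ x, ‖f x‖ ^ p := by
  subst hq
  have h0 : 0 ≤ ∫ x, ‖f x‖ ^ p := integral_nonneg fun x => by positivity
  rw [Lp.norm_def, (Lp.memLp f).eLpNorm_eq_integral_rpow_norm (by simp; linarith)
    ENNReal.ofReal_ne_top, ENNReal.toReal_ofReal (by rw [ENNReal.toReal_ofReal (by linarith)]; positivity),
    ENNReal.toReal_ofReal (by linarith), ← Real.rpow_mul h0, inv_mul_cancel₀ (by linarith),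
    Real.rpow_one]

lemma norm_Lp_add_rpow_add_norm_sub_rpow_le [Fact (1 ≤ ENNReal.ofReal p)] (hp1 : 1 ≤ p)
    (hp2 : p ≤ 2) (f g : Lp ℂ (ENNReal.ofReal p) (volume : Measure ℝ)) :
    ‖f + g‖ ^ p + ‖f - g‖ ^ p ≤ 2 * (‖f‖ ^ p + ‖g‖ ^ p) := by
  simp only [norm_Lp_rpow_eq_integral rfl hp1]
  have hint : ∀ h : Lp ℂ (ENNReal.ofReal p) (volume : Measure ℝ),
      Integrable fun x => ‖h x‖ ^ p := fun h => integrable_norm_rpow_of_memLp hp1 (Lp.memLp h)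
  rw [← integral_add (hint _) (hint _), ← integral_add (hint _) (hint _), ← integral_const_mul]
  refine integral_mono_ae ((hint _).add (hint _)) (((hint _).add (hint _)).const_mul 2) ?_
  filter_upwards [Lp.coeFn_add f g, Lp.coeFn_sub f g] with x h1 h2
  simp only [h1, h2, Pi.add_apply, Pi.sub_apply]
  exact norm_add_rpow_add_norm_sub_rpow_le hp1 hp2 _ _

/-- `L^p ⊆ L^1 + L^2` for `1 ≤ p ≤ 2`. -/
lemma exists_add_integrable_memLp_two (hp1 : 1 ≤ p) (hp2 : p ≤ 2) {f : ℝ → ℂ}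
    (hf : MemLp f (ENNReal.ofReal p) volume) :
    ∃ f₁ f₂ : ℝ → ℂ, f = f₁ + f₂ ∧ Integrable f₁ ∧ MemLp f₂ 2 ∧
      ∫ x, ‖f₁ x‖ ≤ ∫ x, ‖f x‖ ^ p ∧ ∫ x, ‖f₂ x‖ ^ 2 ≤ ∫ x, ‖f x‖ ^ p := by
  classical
  -- Truncation at height `1`: `‖z‖ ≤ ‖z‖ ^ p` above it and `‖z‖ ^ 2 ≤ ‖z‖ ^ p` below it.
  let φ : ℂ → ℂ := fun z => if 1 < ‖z‖ then z else 0
  have hφ : Measurable φ :=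
    Measurable.ite (measurableSet_lt measurable_const measurable_norm) measurable_id
      measurable_const
  have hφle : ∀ z, ‖φ z‖ ≤ ‖z‖ ^ p := by
    intro z
    by_cases hz : 1 < ‖z‖
    · simpa [φ, hz] using Real.rpow_le_rpow_of_exponent_le hz.le hp1
    · simp only [φ, hz, if_false, norm_zero]
      exact Real.rpow_nonneg (norm_nonneg z) p
  have hφle' : ∀ z, ‖z - φ z‖ ^ 2 ≤ ‖z‖ ^ p := by
    intro z
    by_cases hz : 1 < ‖z‖
    · simp only [φ, hz, if_true, sub_self, norm_zero]
      rw [zero_pow two_ne_zero]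
      exact Real.rpow_nonneg (norm_nonneg z) p
    · simp only [φ, hz, if_false, sub_zero]
      rcases (norm_nonneg z).eq_or_lt with h0 | h0
      · rw [← h0, zero_pow two_ne_zero]
        exact Real.rpow_nonneg le_rfl p
      · rw [← Real.rpow_natCast]
        exact Real.rpow_le_rpow_of_exponent_ge h0 (not_lt.1 hz) (by simpa using hp2)
  have hint := integrable_norm_rpow_of_memLp hp1 hf
  have hm1 : AEStronglyMeasurable (fun x => φ (f x)) volume :=
    (hφ.comp_aemeasurable hf.1.aemeasurable).aestronglyMeasurable
  have hm2 : AEStronglyMeasurable (fun x => f x - φ (f x)) volume := hf.1.sub hm1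
  have hi1 : Integrable fun x => φ (f x) := hint.mono' hm1 (.of_forall fun x => hφle _)
  have hi2 : Integrable fun x => ‖f x - φ (f x)‖ ^ 2 :=
    hint.mono' (hm2.norm.pow 2) (.of_forall fun x => by
      rw [Real.norm_of_nonneg (by positivity)]; exact hφle' _)
  refine ⟨fun x => φ (f x), fun x => f x - φ (f x), by ext x; simp, hi1,
    (memLp_two_iff_integrable_sq_norm hm2).2 hi2, ?_, ?_⟩
  · exact integral_mono hi1.norm hint fun x => hφle _
  · exact integral_mono hi2 hint fun x => hφle' _

end Lp

/-! ### The distributional Fourier transform on `L^p`, `1 ≤ p ≤ 2` -/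

section Fourier

open FourierTransform SchwartzMap

/-- The transform `∫ e^{-ixξ} φ(ξ) dξ` of a test function is the normalized Fourier transform of a
Schwartz function. -/
lemma exists_schwartzMap_fourier_eq {φ : ℝ → ℂ} (hφ : ContDiff ℝ ∞ φ) (hφc : HasCompactSupport φ) :
    ∃ ψ : 𝓢(ℝ, ℂ), (∀ η, ψ η = 2 * Real.pi * φ (2 * Real.pi * η)) ∧
      ∀ x : ℝ, 𝓕 ψ x = ∫ ξ : ℝ, Complex.exp (-(Complex.I * x * ξ)) * φ ξ := by
  have hpi : (2 * Real.pi) ≠ 0 := by positivity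
  have h1 : HasCompactSupport fun η : ℝ => (2 * Real.pi : ℂ) * φ (2 * Real.pi * η) := by
    have := hφc.comp_homeomorph (Homeomorph.mulLeft₀ (2 * Real.pi) hpi)
    exact HasCompactSupport.mul_left this
  have h2 : ContDiff ℝ ∞ fun η : ℝ => (2 * Real.pi : ℂ) * φ (2 * Real.pi * η) := by
    fun_prop
  refine ⟨h1.toSchwartzMap h2, fun η => rfl, fun x => ?_⟩
  rw [SchwartzMap.fourier_coe, Real.fourier_real_eq_integral_exp_smul]
  have h3 := Measure.integral_comp_mul_left
    (fun ξ : ℝ => Complex.exp (-(Complex.I * x * ξ)) * φ ξ) (2 * Real.pi)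
  have h4 : ∫ ξ : ℝ, Complex.exp (-(Complex.I * x * ξ)) * φ ξ = (2 * Real.pi : ℂ) *
      ∫ η : ℝ, Complex.exp (-(Complex.I * x * ((2 * Real.pi * η : ℝ) : ℂ))) *
        φ (2 * Real.pi * η) := by
    rw [h3, abs_of_pos (by positivity), Complex.real_smul, ← mul_assoc]
    push_cast
    rw [mul_inv_cancel₀ (by exact_mod_cast hpi), one_mul]
  rw [h4, ← integral_const_mul]
  refine integral_congr_ae (.of_forall fun η => ?_)
  change _ • ((2 * Real.pi : ℂ) * φ (2 * Real.pi * η)) = _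
  rw [smul_eq_mul]
  have h5 : ((-2 * Real.pi * η * x : ℝ) : ℂ) * Complex.I =
      -(Complex.I * x * ((2 * Real.pi * η : ℝ) : ℂ)) := by push_cast; ring
  rw [h5]
  ring

/-- Dilation by `2π` turns the multiplication formula for the kernel `e^{-2πixξ}` into the
convention used here. -/
lemma isFourierTransform_comp_div {f h : ℝ → ℂ}
    (hloc : LocallyIntegrable (fun ξ => h (ξ / (2 * Real.pi))) volume)
    (hfh : ∀ ψ : 𝓢(ℝ, ℂ), ∫ η, h η * ψ η = ∫ x, f x * 𝓕 ψ x) :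
    IsFourierTransform f fun ξ => h (ξ / (2 * Real.pi)) := by
  refine ⟨hloc, fun φ hφ hφc => ?_⟩
  obtain ⟨ψ, hψ, hψF⟩ := exists_schwartzMap_fourier_eq hφ hφc
  simp only [← hψF]
  rw [← hfh]
  have hpi : (2 * Real.pi) ≠ 0 := by positivity
  have h3 := Measure.integral_comp_mul_left
    (fun ξ : ℝ => h (ξ / (2 * Real.pi)) * φ ξ) (2 * Real.pi)
  have h4 : ∫ ξ : ℝ, h (ξ / (2 * Real.pi)) * φ ξ = (2 * Real.pi : ℂ) *
      ∫ η : ℝ, h (2 * Real.pi * η / (2 * Real.pi)) * φ (2 * Real.pi * η) := by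
    rw [h3, abs_of_pos (by positivity), Complex.real_smul, ← mul_assoc]
    push_cast
    rw [mul_inv_cancel₀ (by exact_mod_cast hpi), one_mul]
  rw [h4, ← integral_const_mul]
  refine integral_congr_ae (.of_forall fun η => ?_)
  change _ * (h (2 * Real.pi * η / (2 * Real.pi)) * φ (2 * Real.pi * η)) = h η * ψ η
  rw [mul_div_cancel_left₀ _ hpi, hψ]
  ring

lemma exists_isFourierTransform_of_integrable {f : ℝ → ℂ} (hf : Integrable f) :
    ∃ u : ℝ → ℂ, IsFourierTransform f u ∧ Continuous u ∧ ∀ ξ, ‖u ξ‖ ≤ ∫ x, ‖f x‖ := by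
  have hcont : Continuous (𝓕 f) :=
    VectorFourier.fourierIntegral_continuous Real.continuous_fourierChar
      (by exact continuous_inner) hf
  have hcont' : Continuous fun ξ => 𝓕 f (ξ / (2 * Real.pi)) := by fun_prop
  refine ⟨fun ξ => 𝓕 f (ξ / (2 * Real.pi)),
    isFourierTransform_comp_div hcont'.locallyIntegrable fun ψ => ?_, hcont',
    fun ξ => VectorFourier.norm_fourierIntegral_le_integral_norm _ _ _ _ _⟩
  have := VectorFourier.integral_fourierIntegral_smul_eq_flip (L := innerₗ ℝ)
    Real.continuous_fourierChar continuous_inner hf (ψ.integrable (μ := volume))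
  simpa [SchwartzMap.fourier_coe] using! this

lemma exists_isFourierTransform_of_memLp_two {f : ℝ → ℂ} (hf : MemLp f 2) :
    ∃ v : ℝ → ℂ, IsFourierTransform f v ∧ MemLp v 2 ∧
      ∫ ξ, ‖v ξ‖ ^ 2 = 2 * Real.pi * ∫ x, ‖f x‖ ^ 2 := by
  have hpi : (2 * Real.pi) ≠ 0 := by positivity
  set F : Lp ℂ 2 (volume : Measure ℝ) := hf.toLp f with hF
  set h : Lp ℂ 2 (volume : Measure ℝ) := 𝓕 F with hh
  have hnorm : ∀ g : Lp ℂ 2 (volume : Measure ℝ), ‖g‖ ^ 2 = ∫ x, ‖g x‖ ^ 2 := by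
    intro g
    have := norm_Lp_rpow_eq_integral (p := 2) (by simp) (by norm_num) g
    simpa only [Real.rpow_two] using this
  have hsq : Integrable fun ξ => ‖h ξ‖ ^ 2 :=
    (memLp_two_iff_integrable_sq_norm (Lp.memLp h).1).1 (Lp.memLp h)
  have hae : AEStronglyMeasurable (fun ξ => h (ξ / (2 * Real.pi))) volume :=
    (Lp.stronglyMeasurable h).comp_measurable (by fun_prop) |>.aestronglyMeasurable
  have hmem : MemLp (fun ξ => h (ξ / (2 * Real.pi))) 2 :=
    (memLp_two_iff_integrable_sq_norm hae).2 (hsq.comp_div hpi)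
  refine ⟨_, isFourierTransform_comp_div (hmem.locallyIntegrable (by norm_num)) fun ψ => ?_,
    hmem, ?_⟩
  · have := congrArg (fun T => T ψ) (Lp.fourier_toTemperedDistribution_eq F)
    simp only [TemperedDistribution.fourier_apply, Lp.toTemperedDistribution_apply,
      smul_eq_mul] at this
    calc ∫ η, h η * ψ η = ∫ η, ψ η * h η := by simp only [mul_comm]
      _ = ∫ x, 𝓕 ψ x * F x := this.symm
      _ = ∫ x, f x * 𝓕 ψ x := by
        refine integral_congr_ae ?_
        filter_upwards [hf.coeFn_toLp] with x hx
        rw [hx, mul_comm]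
  · rw [Measure.integral_comp_div (fun ξ => ‖h ξ‖ ^ 2), abs_of_pos (by positivity), smul_eq_mul,
      ← hnorm, hh, Lp.norm_fourier_eq, hnorm]
    congr 1
    refine integral_congr_ae ?_
    filter_upwards [hf.coeFn_toLp] with x hx
    rw [hx]

lemma isFourierTransform_unique {f g g' : ℝ → ℂ} (hg : IsFourierTransform f g)
    (hg' : IsFourierTransform f g') : g =ᵐ[volume] g' := by
  refine ae_eq_of_integral_contDiff_smul_eq hg.1 hg'.1 fun φ hφ hφc => ?_
  have hsm : ContDiff ℝ ∞ fun x => (φ x : ℂ) := Complex.ofRealCLM.contDiff.comp hφ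
  have hcs : HasCompactSupport fun x => (φ x : ℂ) := hφc.comp_left Complex.ofReal_zero
  have h := (hg.2 _ hsm hcs).trans (hg'.2 _ hsm hcs).symm
  simpa only [Complex.real_smul, mul_comm] using h

lemma IsFourierTransform.fourierHat {f g : ℝ → ℂ} (hg : IsFourierTransform f g) :
    IsFourierTransform f (fourierHat f) := by
  have h : ∃ g, IsFourierTransform f g := ⟨g, hg⟩
  rw [LandauSchrodinger.fourierHat, dif_pos h]
  exact h.choose_spec

/-- Equality holds everywhere: `f` enters the defining predicate only through integrals, so the same
representative is chosen. Hence the operators are well defined on `L^p` classes. -/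
lemma fourierHat_congr_ae {f g : ℝ → ℂ} (h : f =ᵐ[volume] g) : fourierHat f = fourierHat g := by
  have hFT : IsFourierTransform f = IsFourierTransform g := by
    ext u
    have : ∀ φ : ℝ → ℂ, ∫ x : ℝ, f x * φ x = ∫ x : ℝ, g x * φ x := fun φ =>
      integral_congr_ae (by filter_upwards [h] with x hx; rw [hx])
    simp only [IsFourierTransform, this]
  unfold fourierHat
  rw [hFT]

lemma IsFourierTransform.add {f g u v : ℝ → ℂ} (hu : IsFourierTransform f u)
    (hv : IsFourierTransform g v)
    (hf : ∀ ψ : 𝓢(ℝ, ℂ), Integrable fun x => f x * ψ x)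
    (hg : ∀ ψ : 𝓢(ℝ, ℂ), Integrable fun x => g x * ψ x) :
    IsFourierTransform (f + g) (u + v) := by
  refine ⟨hu.1.add hv.1, fun φ hφ hφc => ?_⟩
  have hi : ∀ w : ℝ → ℂ, LocallyIntegrable w volume → Integrable fun ξ => w ξ * φ ξ := by
    intro w hw
    simpa [mul_comm] using hw.integrable_smul_left_of_hasCompactSupport hφ.continuous hφc
  have h1 := hu.2 φ hφ hφc
  have h2 := hv.2 φ hφ hφc
  obtain ⟨ψ, -, hψ⟩ := exists_schwartzMap_fourier_eq hφ hφc
  simp only [← hψ] at h1 h2 ⊢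
  simp only [Pi.add_apply, add_mul]
  rw [integral_add (hi u hu.1) (hi v hv.1), integral_add (hf _) (hg _), h1, h2]

lemma IsFourierTransform.const_smul {f u : ℝ → ℂ} (c : ℂ) (hu : IsFourierTransform f u) :
    IsFourierTransform (c • f) (c • u) := by
  refine ⟨hu.1.smul c, fun φ hφ hφc => ?_⟩
  have h : ∀ w φ' : ℝ → ℂ, ∫ x, (c • w) x * φ' x = c * ∫ x, w x * φ' x := fun w φ' => by
    simp only [Pi.smul_apply, smul_eq_mul, mul_assoc, integral_const_mul]
  rw [h, h, hu.2 φ hφ hφc]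

variable {p : ℝ}

lemma integrable_mul_schwartzMap (hp1 : 1 ≤ p) {f : ℝ → ℂ}
    (hf : MemLp f (ENNReal.ofReal p) volume) (ψ : 𝓢(ℝ, ℂ)) :
    Integrable fun x => f x * ψ x := by
  have : ENNReal.HolderConjugate (ENNReal.ofReal p) (1 - (ENNReal.ofReal p)⁻¹)⁻¹ :=
    ENNReal.HolderConjugate.inv_one_sub_inv' (by simpa using hp1)
  exact hf.integrable_mul (ψ.memLp (1 - (ENNReal.ofReal p)⁻¹)⁻¹ volume)

lemma exists_isFourierTransform_add (hp1 : 1 ≤ p) (hp2 : p ≤ 2) {f : ℝ → ℂ}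
    (hf : MemLp f (ENNReal.ofReal p) volume) :
    ∃ u v : ℝ → ℂ, IsFourierTransform f (u + v) ∧ Continuous u ∧ MemLp v 2 ∧
      (∀ ξ, ‖u ξ‖ ≤ ∫ x, ‖f x‖ ^ p) ∧
      ∫ ξ, ‖v ξ‖ ^ 2 ≤ 2 * Real.pi * ∫ x, ‖f x‖ ^ p := by
  obtain ⟨f₁, f₂, rfl, h1, h2, hle1, hle2⟩ := exists_add_integrable_memLp_two hp1 hp2 hf
  obtain ⟨u, hu, hcont, hbd⟩ := exists_isFourierTransform_of_integrable h1
  obtain ⟨v, hv, hmem, hint⟩ := exists_isFourierTransform_of_memLp_two h2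
  refine ⟨u, v, hu.add hv
    (integrable_mul_schwartzMap le_rfl (by simpa [memLp_one_iff_integrable] using h1))
    (integrable_mul_schwartzMap one_le_two (by simpa using h2)), hcont, hmem,
    fun ξ => (hbd ξ).trans hle1, ?_⟩
  rw [hint]
  gcongr

lemma isFourierTransform_fourierHat (hp1 : 1 ≤ p) (hp2 : p ≤ 2) {f : ℝ → ℂ}
    (hf : MemLp f (ENNReal.ofReal p) volume) : IsFourierTransform f (fourierHat f) := by
  obtain ⟨u, v, h, -⟩ := exists_isFourierTransform_add hp1 hp2 hf
  exact h.fourierHat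

lemma fourierHat_add (hp1 : 1 ≤ p) (hp2 : p ≤ 2) {f g : ℝ → ℂ}
    (hf : MemLp f (ENNReal.ofReal p) volume) (hg : MemLp g (ENNReal.ofReal p) volume) :
    fourierHat (f + g) =ᵐ[volume] fourierHat f + fourierHat g :=
  isFourierTransform_unique (isFourierTransform_fourierHat hp1 hp2 (hf.add hg))
    ((isFourierTransform_fourierHat hp1 hp2 hf).add (isFourierTransform_fourierHat hp1 hp2 hg)
      (integrable_mul_schwartzMap hp1 hf) (integrable_mul_schwartzMap hp1 hg))

lemma fourierHat_const_smul (hp1 : 1 ≤ p) (hp2 : p ≤ 2) {f : ℝ → ℂ}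
    (hf : MemLp f (ENNReal.ofReal p) volume) (c : ℂ) :
    fourierHat (c • f) =ᵐ[volume] c • fourierHat f :=
  isFourierTransform_unique (isFourierTransform_fourierHat hp1 hp2 (hf.const_smul c))
    ((isFourierTransform_fourierHat hp1 hp2 hf).const_smul c)

end Fourier

/-! ### The operators as functionals on `L^p`, and finiteness of the maximal function -/

section Operator

lemma integrable_exp_neg_mul_abs_rpow {a s : ℝ} (ha : 0 < a) (hs : 0 < s) :
    Integrable fun ξ : ℝ => Real.exp (-(s * |ξ| ^ a)) := by
  have h := integral_exp_neg_mul_rpow ha hs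
  have h1 : (2 : ℝ) * ∫ x in Set.Ioi (0 : ℝ), Real.exp (-s * x ^ a) ≠ 0 := by
    -- A non-integrable function would have integral `0`, but the Gamma value is positive.
    rw [h]
    have := Real.Gamma_pos_of_pos (s := 1 / a + 1) (by positivity)
    positivity
  rw [← integral_comp_abs (f := fun x => Real.exp (-s * x ^ a))] at h1
  simpa only [neg_mul] using not_imp_comm.1 integral_undef h1

variable {a γ p : ℝ}

/-- For `f̂ = u + v`, bound `u` uniformly and use `‖v‖ e ≤ ‖v‖² + e²`. The estimate is not
homogeneous in `f`, but a bound on the unit ball is enough for a linear functional. -/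
lemma integrable_norm_fourierHat_mul_exp (ha : 0 < a) (hp1 : 1 ≤ p) (hp2 : p ≤ 2) {s : ℝ}
    (hs : 0 < s) {f : ℝ → ℂ} (hf : MemLp f (ENNReal.ofReal p) volume) :
    Integrable (fun ξ => ‖fourierHat f ξ‖ * Real.exp (-(s * |ξ| ^ a))) ∧
      ∫ ξ, ‖fourierHat f ξ‖ * Real.exp (-(s * |ξ| ^ a)) ≤
        (∫ x, ‖f x‖ ^ p) * (∫ ξ : ℝ, Real.exp (-(s * |ξ| ^ a))) +
          (2 * Real.pi * (∫ x, ‖f x‖ ^ p) + ∫ ξ : ℝ, Real.exp (-((2 * s) * |ξ| ^ a))) := by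
  obtain ⟨u, v, huv, hu, hv, hule, hvle⟩ := exists_isFourierTransform_add hp1 hp2 hf
  have hae : fourierHat f =ᵐ[volume] u + v :=
    isFourierTransform_unique (isFourierTransform_fourierHat hp1 hp2 hf) huv
  have hv2 := (memLp_two_iff_integrable_sq_norm hv.1).1 hv
  have he1 := integrable_exp_neg_mul_abs_rpow ha hs
  have he2 := integrable_exp_neg_mul_abs_rpow (s := 2 * s) ha (by positivity)
  have hdom : Integrable fun ξ => (∫ x, ‖f x‖ ^ p) * Real.exp (-(s * |ξ| ^ a)) +
      (‖v ξ‖ ^ 2 + Real.exp (-((2 * s) * |ξ| ^ a))) :=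
    (he1.const_mul _).add (hv2.add he2)
  have hle : ∀ᵐ ξ : ℝ, ‖fourierHat f ξ‖ * Real.exp (-(s * |ξ| ^ a)) ≤
      (∫ x, ‖f x‖ ^ p) * Real.exp (-(s * |ξ| ^ a)) +
        (‖v ξ‖ ^ 2 + Real.exp (-((2 * s) * |ξ| ^ a))) := by
    filter_upwards [hae] with ξ hξ
    rw [hξ, Pi.add_apply]
    have h1 : Real.exp (-((2 * s) * |ξ| ^ a)) = Real.exp (-(s * |ξ| ^ a)) ^ 2 := by
      rw [← Real.exp_nat_mul]; congr 1; push_cast; ring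
    rw [h1]
    set e := Real.exp (-(s * |ξ| ^ a))
    have he : 0 ≤ e := (Real.exp_pos _).le
    have h2 : ‖u ξ + v ξ‖ * e ≤ (‖u ξ‖ + ‖v ξ‖) * e := by
      gcongr; exact norm_add_le _ _
    have h3 : ‖u ξ‖ * e ≤ (∫ x, ‖f x‖ ^ p) * e := by
      gcongr; exact hule ξ
    nlinarith [sq_nonneg (‖v ξ‖ - e), sq_nonneg (‖v ξ‖), sq_nonneg e]
  have hmeas : AEStronglyMeasurable
      (fun ξ : ℝ => ‖fourierHat f ξ‖ * Real.exp (-(s * |ξ| ^ a))) volume :=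
    ((hu.aestronglyMeasurable.add hv.1).congr hae.symm).norm.mul he1.1
  have hint := hdom.mono' hmeas (by
    filter_upwards [hle] with ξ hξ
    rwa [Real.norm_of_nonneg (by positivity)])
  refine ⟨hint, (integral_mono_ae hint hdom hle).trans ?_⟩
  have hsplit := integral_add hv2 he2
  rw [integral_add (he1.const_mul _) (by exact hv2.add he2), hsplit, integral_const_mul]
  gcongr

/-- The integrand defining `landauOp`. -/
noncomputable def landauIntegrand (a γ t : ℝ) (f : ℝ → ℂ) (x ξ : ℝ) : ℂ :=
  fourierHat f ξ * Complex.exp (Complex.I * x * ξ) *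
    Complex.exp (Complex.I * t * ((|ξ| ^ a : ℝ) : ℂ)) *
    ((Real.exp (-(t ^ γ * |ξ| ^ a)) : ℝ) : ℂ)

lemma landauOp_eq (t : ℝ) (f : ℝ → ℂ) (x : ℝ) :
    landauOp a γ t f x = (1 / (2 * (Real.pi : ℂ))) * ∫ ξ, landauIntegrand a γ t f x ξ := rfl

lemma norm_landauIntegrand (t : ℝ) (f : ℝ → ℂ) (x ξ : ℝ) :
    ‖landauIntegrand a γ t f x ξ‖ = ‖fourierHat f ξ‖ * Real.exp (-(t ^ γ * |ξ| ^ a)) := by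
  have h1 : ‖Complex.exp (Complex.I * x * ξ)‖ = 1 := by
    rw [mul_assoc, mul_comm, ← Complex.ofReal_mul, Complex.norm_exp_ofReal_mul_I]
  have h2 : ‖Complex.exp (Complex.I * t * ((|ξ| ^ a : ℝ) : ℂ))‖ = 1 := by
    rw [mul_assoc, mul_comm, ← Complex.ofReal_mul, Complex.norm_exp_ofReal_mul_I]
  rw [landauIntegrand, norm_mul, norm_mul, norm_mul, h1, h2, Complex.norm_real,
    Real.norm_of_nonneg (Real.exp_pos _).le]
  ring

lemma aestronglyMeasurable_landauIntegrand (ha : 0 < a) (hp1 : 1 ≤ p) (hp2 : p ≤ 2) (t : ℝ)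
    {f : ℝ → ℂ} (hf : MemLp f (ENNReal.ofReal p) volume) (x : ℝ) :
    AEStronglyMeasurable (landauIntegrand a γ t f x) volume := by
  have habs : Continuous fun ξ : ℝ => |ξ| ^ a :=
    continuous_abs.rpow_const fun _ => Or.inr ha.le
  have h1 : AEStronglyMeasurable (fourierHat f) volume :=
    (isFourierTransform_fourierHat hp1 hp2 hf).1.aestronglyMeasurable
  have h2 : Continuous fun ξ : ℝ => Complex.exp (Complex.I * x * ξ) := by fun_prop
  have h3 : Continuous fun ξ : ℝ => Complex.exp (Complex.I * t * ((|ξ| ^ a : ℝ) : ℂ)) := by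
    fun_prop
  have h4 : Continuous fun ξ : ℝ => ((Real.exp (-(t ^ γ * |ξ| ^ a)) : ℝ) : ℂ) := by fun_prop
  exact ((h1.mul h2.aestronglyMeasurable).mul h3.aestronglyMeasurable).mul h4.aestronglyMeasurable

lemma integrable_landauIntegrand (ha : 0 < a) (hp1 : 1 ≤ p) (hp2 : p ≤ 2) {t : ℝ} (ht : 0 < t)
    {f : ℝ → ℂ} (hf : MemLp f (ENNReal.ofReal p) volume) (x : ℝ) :
    Integrable (landauIntegrand a γ t f x) :=
  (integrable_norm_fourierHat_mul_exp ha hp1 hp2 (Real.rpow_pos_of_pos ht γ) hf).1.mono'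
    (aestronglyMeasurable_landauIntegrand ha hp1 hp2 t hf x)
    (.of_forall fun ξ => (norm_landauIntegrand t f x ξ).le)

lemma norm_landauOp_le (t : ℝ) (f : ℝ → ℂ) (x : ℝ) :
    ‖landauOp a γ t f x‖ ≤ ∫ ξ, ‖fourierHat f ξ‖ * Real.exp (-(t ^ γ * |ξ| ^ a)) := by
  rw [landauOp_eq, norm_mul]
  have h1 : ‖1 / (2 * (Real.pi : ℂ))‖ ≤ 1 := by
    rw [norm_div, norm_mul, Complex.norm_real, Real.norm_of_nonneg Real.pi_pos.le]
    simp only [norm_one, Complex.norm_ofNat]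
    rw [div_le_one (by positivity)]
    linarith [Real.pi_gt_three]
  refine (mul_le_of_le_one_left (norm_nonneg _) h1).trans ((norm_integral_le_integral_norm _).trans
    (le_of_eq ?_))
  simp only [norm_landauIntegrand]

lemma landauOp_congr_ae {f g : ℝ → ℂ} (h : f =ᵐ[volume] g) (t : ℝ) :
    landauOp a γ t f = landauOp a γ t g := by
  ext x
  simp only [landauOp, fourierHat_congr_ae h]

lemma landauOp_add (ha : 0 < a) (hp1 : 1 ≤ p) (hp2 : p ≤ 2) {t : ℝ} (ht : 0 < t) {f g : ℝ → ℂ}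
    (hf : MemLp f (ENNReal.ofReal p) volume) (hg : MemLp g (ENNReal.ofReal p) volume) (x : ℝ) :
    landauOp a γ t (f + g) x = landauOp a γ t f x + landauOp a γ t g x := by
  simp only [landauOp_eq]
  rw [← mul_add, ← integral_add (integrable_landauIntegrand ha hp1 hp2 ht hf x)
    (integrable_landauIntegrand ha hp1 hp2 ht hg x)]
  congr 1
  refine integral_congr_ae ?_
  filter_upwards [fourierHat_add hp1 hp2 hf hg] with ξ hξ
  simp only [landauIntegrand, hξ, Pi.add_apply]
  ring

lemma landauOp_const_smul (hp1 : 1 ≤ p) (hp2 : p ≤ 2) (t : ℝ) {f : ℝ → ℂ}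
    (hf : MemLp f (ENNReal.ofReal p) volume) (c : ℂ) (x : ℝ) :
    landauOp a γ t (c • f) x = c * landauOp a γ t f x := by
  simp only [landauOp_eq]
  rw [mul_left_comm, ← integral_const_mul c]
  congr 1
  refine integral_congr_ae ?_
  filter_upwards [fourierHat_const_smul hp1 hp2 hf c] with ξ hξ
  simp only [landauIntegrand, hξ, Pi.smul_apply, smul_eq_mul]
  ring

lemma continuous_landauOp (ha : 0 < a) (hp1 : 1 ≤ p) (hp2 : p ≤ 2) {t : ℝ} (ht : 0 < t)
    {f : ℝ → ℂ} (hf : MemLp f (ENNReal.ofReal p) volume) : Continuous (landauOp a γ t f) := by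
  have h : Continuous fun x => ∫ ξ, landauIntegrand a γ t f x ξ := by
    refine continuous_of_dominated
      (fun x => aestronglyMeasurable_landauIntegrand ha hp1 hp2 t hf x)
      (fun x => .of_forall fun ξ => (norm_landauIntegrand t f x ξ).le)
      (integrable_norm_fourierHat_mul_exp ha hp1 hp2 (Real.rpow_pos_of_pos ht γ) hf).1
      (.of_forall fun ξ => ?_)
    unfold landauIntegrand
    fun_prop
  exact continuous_const.mul h

lemma exists_landauOp_clm (γ : ℝ) [Fact (1 ≤ ENNReal.ofReal p)] (ha : 0 < a) (hp1 : 1 ≤ p)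
    (hp2 : p ≤ 2) {t : ℝ} (ht : 0 < t) (x : ℝ) :
    ∃ Φ : Lp ℂ (ENNReal.ofReal p) (volume : Measure ℝ) →L[ℂ] ℂ,
      ∀ f, Φ f = landauOp a γ t f x := by
  let Φ : Lp ℂ (ENNReal.ofReal p) (volume : Measure ℝ) →ₗ[ℂ] ℂ :=
    { toFun := fun f => landauOp a γ t f x
      map_add' := fun f g => by
        rw [landauOp_congr_ae (Lp.coeFn_add f g),
          landauOp_add ha hp1 hp2 ht (Lp.memLp f) (Lp.memLp g)]
      map_smul' := fun c f => by
        rw [landauOp_congr_ae (Lp.coeFn_smul c f), landauOp_const_smul hp1 hp2 t (Lp.memLp f)]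
        rfl }
  set s := t ^ γ with hs
  have hspos : 0 < s := Real.rpow_pos_of_pos ht γ
  have hbound : ∃ C, ∀ f, ‖Φ f‖ ≤ C * ‖f‖ := by
    refine Φ.bound_of_ball_bound one_pos ((∫ ξ : ℝ, Real.exp (-(s * |ξ| ^ a))) +
      (2 * Real.pi + ∫ ξ : ℝ, Real.exp (-((2 * s) * |ξ| ^ a)))) fun f hf => ?_
    have hf1 : ∫ x, ‖f x‖ ^ p ≤ 1 := by
      rw [← norm_Lp_rpow_eq_integral rfl hp1]
      exact Real.rpow_le_one (norm_nonneg f) (mem_ball_zero_iff.1 hf).le (by linarith)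
    have h0 : 0 ≤ ∫ ξ : ℝ, Real.exp (-(s * |ξ| ^ a)) :=
      integral_nonneg fun _ => (Real.exp_pos _).le
    refine (norm_landauOp_le t f x).trans
      ((integrable_norm_fourierHat_mul_exp ha hp1 hp2 hspos (Lp.memLp f)).2.trans ?_)
    have h1 := mul_le_mul_of_nonneg_right hf1 h0
    have h2 := mul_le_mul_of_nonneg_left hf1 (by positivity : 0 ≤ 2 * Real.pi)
    linarith
  exact ⟨Φ.mkContinuousOfExistsBound hbound, fun f => rfl⟩

/-- A supremum of continuous functions, even over uncountably many `t`, is lower semicontinuous. -/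
lemma measurable_landauMaximal (ha : 0 < a) (hp1 : 1 ≤ p) (hp2 : p ≤ 2) {f : ℝ → ℂ}
    (hf : MemLp f (ENNReal.ofReal p) volume) : Measurable (landauMaximal a γ f) := by
  have h : LowerSemicontinuous (landauMaximal a γ f) :=
    lowerSemicontinuous_biSup fun t ht =>
      (continuous_landauOp ha hp1 hp2 ht.1 hf).enorm.lowerSemicontinuous
  exact h.measurable

lemma landauMaximal_lt_top (ha : 0 < a) (hγ : 0 < γ) (hp1 : 1 ≤ p) (hp2 : p ≤ 2) {f : ℝ → ℂ}
    (hf : MemLp f (ENNReal.ofReal p) volume) {x : ℝ} {z : ℂ}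
    (hx : Tendsto (fun t : ℝ => landauOp a γ t f x) (𝓝[>] (0 : ℝ)) (𝓝 z)) :
    landauMaximal a γ f x < ⊤ := by
  have hev := hx.norm.eventually_lt_const (lt_add_one ‖z‖)
  obtain ⟨δ, hδ, hδlt⟩ := mem_nhdsGT_iff_exists_Ioo_subset.1 hev
  have hδ0 : 0 < δ := hδ
  have hspos : 0 < δ ^ γ := Real.rpow_pos_of_pos hδ0 γ
  set B := ∫ ξ, ‖fourierHat f ξ‖ * Real.exp (-(δ ^ γ * |ξ| ^ a)) with hB
  refine lt_of_le_of_lt (b := ENNReal.ofReal (max (‖z‖ + 1) B)) ?_ ENNReal.ofReal_lt_top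
  refine iSup₂_le fun t ht => ?_
  rw [← ofReal_norm]
  refine ENNReal.ofReal_le_ofReal ?_
  rcases lt_or_ge t δ with h | h
  · exact le_max_of_le_left (le_of_lt (hδlt ⟨ht.1, h⟩))
  -- For `t ≥ δ` the damping is at least that at `δ`, so one integral dominates all these `t`,
  -- whatever `x` is.
  · refine le_max_of_le_right ((norm_landauOp_le t f x).trans (integral_mono
      (integrable_norm_fourierHat_mul_exp ha hp1 hp2 (Real.rpow_pos_of_pos ht.1 γ) hf).1
      (integrable_norm_fourierHat_mul_exp ha hp1 hp2 hspos hf).1 fun ξ => ?_))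
    have : δ ^ γ ≤ t ^ γ := Real.rpow_le_rpow hδ0.le h hγ.le
    dsimp only
    gcongr

end Operator

end LandauSchrodinger

/-! ### Nikishin's theorem applied on `[0, 1]` -/

theorem theorem2p1 (a γ p : ℝ) (ha : 0 < a) (hγ : 1 < γ) (hp1 : 1 ≤ p) (hp2 : p < 2)
    (hconv : ∀ f : ℝ → ℂ, MemLp f (ENNReal.ofReal p) volume →
      ∀ᵐ x : ℝ, Tendsto (fun t : ℝ => LandauSchrodinger.landauOp a γ t f x)
        (𝓝[>] (0 : ℝ)) (𝓝 (f x))) :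
    ∀ ε : ℝ, 0 < ε →
      ∃ E : Set ℝ, E ⊆ Set.Icc (0 : ℝ) 1 ∧ MeasurableSet E ∧ 1 - ε < volume.real E ∧
        ∃ C : ℝ, 0 < C ∧
          ∀ lam : ℝ, 0 < lam → ∀ f : ℝ → ℂ, MemLp f (ENNReal.ofReal p) volume →
            volume {x : ℝ | x ∈ E ∧
                ENNReal.ofReal lam < LandauSchrodinger.landauMaximal a γ f x} ≤
              ENNReal.ofReal (C * lam ^ (-p)) *
                eLpNorm f (ENNReal.ofReal p) volume ^ p := by
  intro ε hε
  have hp0 : 0 < p := by linarith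
  have : Fact (1 ≤ ENNReal.ofReal p) := ⟨by simpa using hp1⟩
  choose T hT using fun (t : Set.Ioo (0 : ℝ) 1) (x : ℝ) =>
    LandauSchrodinger.exists_landauOp_clm (p := p) γ ha hp1 hp2.le t.2.1 x
  have hmax : ∀ f : Lp ℂ (ENNReal.ofReal p) (volume : Measure ℝ),
      LandauSchrodinger.maximalFn T f = LandauSchrodinger.landauMaximal a γ f := by
    intro f
    ext x
    simp only [LandauSchrodinger.maximalFn, LandauSchrodinger.landauMaximal, hT, iSup_subtype]
  have : IsProbabilityMeasure (volume.restrict (Set.Icc (0 : ℝ) 1)) := ⟨by simp⟩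
  obtain ⟨G, hGm, hG, C, hC, hweak⟩ := LandauSchrodinger.exists_weakType_maximalFn T
    (μ := volume.restrict (Set.Icc (0 : ℝ) 1)) hp0
    (LandauSchrodinger.norm_Lp_add_rpow_add_norm_sub_rpow_le hp1 hp2.le)
    (fun f => by
      rw [hmax]; exact LandauSchrodinger.measurable_landauMaximal ha hp1 hp2.le (Lp.memLp f))
    (fun f => by
      rw [hmax]
      refine ae_restrict_of_ae ?_
      filter_upwards [hconv f (Lp.memLp f)] with x hx
      exact LandauSchrodinger.landauMaximal_lt_top ha (by linarith) hp1 hp2.le (Lp.memLp f) hx)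
    -- Half of `ε`, because the measure of `E` must strictly exceed `1 - ε`.
    (η := ε / 2) (by positivity)
  refine ⟨G ∩ Set.Icc 0 1, Set.inter_subset_right, hGm.inter measurableSet_Icc, ?_, C ^ p,
    by positivity, fun lam hlam f hf => ?_⟩
  · have h1 : (volume.restrict (Set.Icc (0 : ℝ) 1)).real Gᶜ ≤ ε / 2 :=
      ENNReal.toReal_le_of_le_ofReal (by positivity) hG
    rw [measureReal_compl hGm, probReal_univ, measureReal_restrict_apply hGm] at h1
    linarith
  · have hF : (hf.toLp f : ℝ → ℂ) =ᵐ[volume] f := hf.coeFn_toLp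
    have hmaxF : LandauSchrodinger.landauMaximal a γ f =
        LandauSchrodinger.maximalFn T (hf.toLp f) := by
      rw [hmax]
      ext x
      simp only [LandauSchrodinger.landauMaximal, LandauSchrodinger.landauOp_congr_ae hF]
    have h1 := hweak lam hlam (hf.toLp f)
    rw [← hmaxF, Measure.restrict_apply' measurableSet_Icc] at h1
    have hset : {x : ℝ | x ∈ G ∩ Set.Icc (0 : ℝ) 1 ∧
        ENNReal.ofReal lam < LandauSchrodinger.landauMaximal a γ f x} =
        G ∩ {x | ENNReal.ofReal lam < LandauSchrodinger.landauMaximal a γ f x} ∩ Set.Icc 0 1 := by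
      ext x
      simp only [Set.mem_inter_iff, Set.mem_ofPred_eq]
      tauto
    rw [hset]
    refine h1.trans (le_of_eq ?_)
    rw [Lp.norm_toLp, Real.mul_rpow (by positivity) ENNReal.toReal_nonneg,
      ENNReal.ofReal_mul (by positivity), ← ENNReal.ofReal_rpow_of_nonneg ENNReal.toReal_nonneg
      hp0.le, ENNReal.ofReal_toReal hf.2.ne, Real.div_rpow hC.le hlam.le, Real.rpow_neg hlam.le,
      div_eq_mul_inv]
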